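/- Let $n\ge 0$ and $r\ge 2$ be integers and let $A$ be an $n\times n$ real matrix with nonnegative entries which is $r$-potent, i.e. $A^r=A$. Call an $n\times n$ real matrix $A$ decomposable if there are an $n\times n$ permutation matrix $P$ and an integer $k$ with $0<k<n$ such that $$P^{-1}AP=\begin{pmatrix} B & C\\ 0 & D\end{pmatrix}$$ with $B$ of size $k\times k$ and $D$ of size $(n-k)\times(n-k)$. Then: (1) If $\operatorname{rank}(A)>r-1$, then $A$ is decomposable. (2) Suppose $n\ge 2$ and $r\ge 3$. If $\operatorname{rank}(A)\le r-1$, $A$ is singular, and each of the matrices $A^2,A^3,\ldots,A^{r-1}$ has at least one diagonal entry equal to zero, then $A$ is decomposable. -/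

import Mathlib

/-- A real square matrix `A` of order `n` is decomposable if there is a permutation matrix `P`
such that `P⁻¹ * A * P` is block upper triangular with (nonempty) square diagonal blocks, of
orders `k` and `n - k` with `0 < k < n`: the lower left block, in the rows with index at least `k`
and the columns with index less than `k` (counted from `0`), vanishes. -/
def Matrix.IsDecomposable {n : ℕ} (A : Matrix (Fin n) (Fin n) ℝ) : Prop :=
  ∃ (σ : Equiv.Perm (Fin n)) (k : ℕ), 0 < k ∧ k < n ∧
    ∀ i j : Fin n, k ≤ (i : ℕ) → (j : ℕ) < k →
      ((σ.permMatrix ℝ)⁻¹ * A * σ.permMatrix ℝ) i j = 0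

/-!
If `A` is indecomposable, then its digraph is strongly connected. Put `p = r - 1`; then `E = A ^ p`
is idempotent, so all positive powers of `E` have the same support as `E`, and hence
`E i j > 0` as soon as some walk from `i` to `j` has positive length divisible by `p`. Going
round a closed walk `p` times shows that `E` has positive diagonal. Label each index `j` by the
length modulo `p` of a walk to `j` from a base point. Any two indices with equal labels are joined
by a walk of length divisible by `p`, so `E` is positive there, and the maximum principle applied to
the difference of one column and the largest multiple of the other below it shows that the two
columns of `E` are proportional. Hence `rank A ≤ rank E ≤ p`.
-/

open Matrix

theorem isIdempotentElem_pow_of_pow_succ_eq {M : Type*} [Monoid M] {a : M} {p : ℕ} (hp : p ≠ 0)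
    (h : a ^ (p + 1) = a) : IsIdempotentElem (a ^ p) := by
  obtain ⟨q, rfl⟩ := Nat.exists_eq_succ_of_ne_zero hp
  calc a ^ (q + 1) * a ^ (q + 1) = a ^ q * a ^ (q + 1 + 1) := by
        rw [← pow_add, ← pow_add, add_right_comm, add_assoc]
    _ = a ^ (q + 1) := by rw [h, pow_succ]

namespace NonnegMatrix

/-- Reducibility of a square matrix without reference to an ordering of its index type: some
nonempty proper set `S` of indices supports the lower left zero block, in the rows outside `S` and
the columns in `S`. Over `Fin n` this yields `Matrix.IsDecomposable`. The `1 × 1` zero matrix is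
neither reducible nor irreducible in the sense of `Matrix.IsIrreducible`. -/
def IsReducible {ι R : Type*} [Zero R] (A : Matrix ι ι R) : Prop :=
  ∃ S : Set ι, S.Nonempty ∧ S ≠ Set.univ ∧ ∀ i ∉ S, ∀ j ∈ S, A i j = 0

section Decomposable

theorem inv_permMatrix_mul_mul_permMatrix_apply {ι R : Type*} [Fintype ι] [DecidableEq ι]
    [CommRing R] (σ : Equiv.Perm ι) (A : Matrix ι ι R) (i j : ι) :
    ((σ.permMatrix R)⁻¹ * A * σ.permMatrix R) i j = A (σ⁻¹ i) (σ⁻¹ j) := by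
  have hinv : (σ.permMatrix R)⁻¹ = (σ⁻¹).permMatrix R :=
    inv_eq_left_inv <| by rw [← permMatrix_mul, mul_inv_cancel, permMatrix_one]
  rw [hinv, PEquiv.mul_toMatrix_toPEquiv, PEquiv.toMatrix_toPEquiv_mul]
  rfl

theorem exists_perm_apply_mem_iff_lt_ncard {n : ℕ} (S : Set (Fin n)) :
    ∃ σ : Equiv.Perm (Fin n), ∀ i, σ i ∈ S ↔ (i : ℕ) < S.ncard := by
  classical
  have hcard : Nat.card {i : Fin n // (i : ℕ) < S.ncard} = Nat.card S := by
    have hle : S.ncard ≤ n := by simpa using Set.ncard_le_card S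
    rw [Nat.subtype_card (Finset.univ.filter fun i : Fin n => (i : ℕ) < S.ncard) (by simp),
      Fin.card_filter_val_lt, min_eq_right hle, Nat.card_coe_set_eq]
  obtain ⟨e⟩ := Finite.card_eq.1 hcard
  exact ⟨e.extendSubtype, fun i => ⟨not_imp_not.1 (e.extendSubtype_not_mem i),
    e.extendSubtype_mem i⟩⟩

theorem IsReducible.isDecomposable {n : ℕ} {A : Matrix (Fin n) (Fin n) ℝ} (hA : IsReducible A) :
    A.IsDecomposable := by
  obtain ⟨S, hne, hproper, hS⟩ := hA
  obtain ⟨σ, hσ⟩ := exists_perm_apply_mem_iff_lt_ncard S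
  refine ⟨σ⁻¹, S.ncard, hne.ncard_pos, by simpa using Set.ncard_lt_card hproper,
    fun i j hi hj => ?_⟩
  rw [inv_permMatrix_mul_mul_permMatrix_apply, inv_inv]
  exact hS _ (mt (hσ i).1 hi.not_gt) _ ((hσ j).2 hj)

end Decomposable

theorem isIrreducible_of_not_isReducible {ι R : Type*} [Nontrivial ι] [Ring R] [LinearOrder R]
    {A : Matrix ι ι R} (hA : ∀ i j, 0 ≤ A i j) (hred : ¬ IsReducible A) : A.IsIrreducible := by
  let _ := A.toQuiver
  have hconn : Quiver.IsStronglyConnected ι := by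
    intro i t
    by_contra hit
    refine hred ⟨{k | Nonempty (Quiver.Path k t)}, ⟨t, ⟨.nil⟩⟩,
      fun h => hit (h.ge (Set.mem_univ i)), fun k hk l ⟨path⟩ => ?_⟩
    by_contra hkl
    have hkl_pos : 0 < A k l := (hA k l).lt_of_ne' hkl
    exact hk ⟨(Quiver.Hom.toPath (PLift.up hkl_pos : k ⟶ l)).comp path⟩
  obtain ⟨i, j, hij⟩ := exists_pair_ne ι
  obtain ⟨path⟩ := hconn i j
  cases path with
  | nil => exact absurd rfl hij
  | cons _ edge => exact ⟨hA, hconn.isSStronglyConnected_of_hom edge⟩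

section Walks

variable {l m n R : Type*} [Semiring R] [PartialOrder R] [IsStrictOrderedRing R]

theorem mul_apply_pos [Fintype m] {A : Matrix l m R} {B : Matrix m n R} (hA : ∀ i j, 0 ≤ A i j)
    (hB : ∀ i j, 0 ≤ B i j) {i : l} {j : m} {k : n} (hij : 0 < A i j) (hjk : 0 < B j k) :
    0 < (A * B) i k :=
  Finset.sum_pos' (fun _ _ => mul_nonneg (hA _ _) (hB _ _))
    ⟨j, Finset.mem_univ j, mul_pos hij hjk⟩

variable [Fintype n] [DecidableEq n] {A : Matrix n n R} {i j k : n} {a b p : ℕ}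

theorem pow_add_apply_pos (hA : ∀ i j, 0 ≤ A i j) (hij : 0 < (A ^ a) i j)
    (hjk : 0 < (A ^ b) j k) : 0 < (A ^ (a + b)) i k := by
  rw [pow_add]
  exact mul_apply_pos (pow_apply_nonneg hA a) (pow_apply_nonneg hA b) hij hjk

theorem pow_mul_apply_self_pos (hA : ∀ i j, 0 ≤ A i j) (hi : 0 < (A ^ a) i i) (q : ℕ) :
    0 < (A ^ (a * q)) i i := by
  induction q with
  | zero => simp
  | succ q ih => exact pow_add_apply_pos hA ih hi

theorem pow_apply_pos_of_modEq (hA : ∀ i j, 0 ≤ A i j) (hidem : IsIdempotentElem (A ^ p))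
    (hp : p ≠ 0) (hb : b ≠ 0) (hab : a ≡ b [MOD p]) (hi : 0 < (A ^ a) i i)
    (hij : 0 < (A ^ b) i j) : 0 < (A ^ p) i j := by
  obtain ⟨s, rfl⟩ := Nat.exists_eq_succ_of_ne_zero hp
  -- Going round the closed walk `s = p - 1` times first makes the total length divisible by `p`.
  have hpos : 0 < (A ^ (a * s + b)) i j :=
    pow_add_apply_pos hA (pow_mul_apply_self_pos hA hi s) hij
  have hdvd : s + 1 ∣ a * s + b := by
    rw [← Nat.modEq_zero_iff_dvd]
    calc a * s + b ≡ a * s + a [MOD s + 1] := hab.symm.add_left _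
      _ ≡ 0 [MOD s + 1] := Nat.modEq_zero_iff_dvd.2 (dvd_mul_left (s + 1) a)
  obtain ⟨q, hq⟩ := hdvd
  have hq0 : q ≠ 0 := by rintro rfl; omega
  rwa [hq, pow_mul, hidem.pow_eq hq0] at hpos

end Walks

section MaximumPrinciple

theorem apply_eq_zero_of_mulVec_apply_eq_zero {m n R : Type*} [Fintype n] [Semiring R]
    [PartialOrder R] [IsOrderedRing R] [NoZeroDivisors R] {B : Matrix m n R}
    (hB : ∀ i j, 0 ≤ B i j) {v : n → R} (hv : 0 ≤ v) {i : m} {j : n} (h : (B *ᵥ v) i = 0)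
    (hij : 0 < B i j) : v j = 0 := by
  have hterm : B i j * v j = 0 :=
    (Finset.sum_eq_zero_iff_of_nonneg fun k _ => mul_nonneg (hB i k) (hv k)).1 h j
      (Finset.mem_univ j)
  exact (mul_eq_zero.1 hterm).resolve_left hij.ne'

theorem col_eq_smul_col_of_isIdempotentElem {ι R : Type*} [Fintype ι] [Field R] [LinearOrder R]
    [IsStrictOrderedRing R] {E : Matrix ι ι R} (hE : ∀ i j, 0 ≤ E i j)
    (hidem : IsIdempotentElem E) (hsymm : ∀ i j, 0 < E i j → 0 < E j i) {j k : ι}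
    (hjk : 0 < E j k) : ∃ c : R, E.col j = c • E.col k := by
  have htrans {a b c : ι} (hab : 0 < E a b) (hbc : 0 < E b c) : 0 < E a c := by
    rw [← hidem.eq]; exact mul_apply_pos hE hE hab hbc
  obtain ⟨i₀, hi₀, hmin⟩ : ∃ i₀, 0 < E i₀ k ∧ ∀ i, 0 < E i k → E i₀ j / E i₀ k ≤ E i j / E i k := by
    simpa using Finset.exists_min_image {i | 0 < E i k} (fun i => E i j / E i k)
      ⟨j, by simpa using hjk⟩
  set c := E i₀ j / E i₀ k
  set v := E.col j - c • E.col k with hv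
  have hv_apply (i : ι) : v i = E i j - c * E i k := rfl
  have hv_off {i : ι} (hi : ¬ 0 < E i k) : v i = 0 := by
    have hik : E i k = 0 := (not_lt.1 hi).antisymm (hE i k)
    have hij : E i j = 0 := (not_lt.1 fun h => hi (htrans h hjk)).antisymm (hE i j)
    rw [hv_apply, hik, hij, mul_zero, sub_zero]
  have hv_nonneg : 0 ≤ v := fun i => by
    by_cases hi : 0 < E i k
    · exact sub_nonneg.2 ((le_div_iff₀ hi).1 (hmin i hi))
    · exact (hv_off hi).ge
  have hv_fixed : E *ᵥ v = v := by
    have hcol (l : ι) : E *ᵥ E.col l = E.col l := congrFun (congrArg Matrix.col hidem.eq) l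
    rw [hv, mulVec_sub, mulVec_smul, hcol, hcol]
  have hv_i₀ : (E *ᵥ v) i₀ = 0 := by
    rw [hv_fixed, hv_apply, div_mul_cancel₀ _ hi₀.ne', sub_self]
  refine ⟨c, sub_eq_zero.1 (funext fun i => ?_)⟩
  by_cases hi : 0 < E i k
  · exact apply_eq_zero_of_mulVec_apply_eq_zero hE hv_nonneg hv_i₀ (htrans hi₀ (hsymm i k hi))
  · exact hv_off hi

end MaximumPrinciple

theorem rank_le_card_of_forall_col_eq_smul {m n κ R : Type*} [Fintype n] [Fintype κ]
    [CommRing R] [StrongRankCondition R] {B : Matrix m n R} (label : n → κ)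
    (h : ∀ j k, label j = label k → ∃ c : R, B.col j = c • B.col k) :
    B.rank ≤ Fintype.card κ := by
  classical
  let representative : Set.range label → n := Set.rangeSplitting label
  have hspan : Set.range B.col ⊆ Submodule.span R (Set.range (B.col ∘ representative)) := by
    rintro _ ⟨j, rfl⟩
    obtain ⟨c, hc⟩ := h j (representative ⟨label j, j, rfl⟩)
      (Set.apply_rangeSplitting label ⟨label j, j, rfl⟩).symm
    rw [hc]
    exact Submodule.smul_mem _ _ (Submodule.subset_span ⟨_, rfl⟩)
  have := Module.Finite.span_of_finite R (Set.finite_range (B.col ∘ representative))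
  calc B.rank = Module.finrank R (Submodule.span R (Set.range B.col)) := rank_eq_finrank_span_cols B
    _ ≤ Module.finrank R (Submodule.span R (Set.range (B.col ∘ representative))) :=
      Submodule.finrank_mono (Submodule.span_le.2 hspan)
    _ ≤ Fintype.card (Set.range label) := finrank_range_le_card _
    _ ≤ Fintype.card κ := Fintype.card_subtype_le _

section Irreducible

variable {ι R : Type*} [Fintype ι] [DecidableEq ι] [LinearOrder R] {p : ℕ}

theorem pow_apply_self_pos_of_isIrreducible [Ring R] [IsStrictOrderedRing R] {A : Matrix ι ι R}
    (hA : A.IsIrreducible) (hp : p ≠ 0) (hidem : IsIdempotentElem (A ^ p)) (i : ι) :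
    0 < (A ^ p) i i := by
  obtain ⟨a, ha, hi⟩ := (isIrreducible_iff_exists_pow_pos hA.nonneg).1 hA i i
  exact pow_apply_pos_of_modEq hA.nonneg hidem hp ha.ne' rfl hi hi

theorem pow_apply_pos_symm_of_isIrreducible [Ring R] [IsStrictOrderedRing R] {A : Matrix ι ι R}
    (hA : A.IsIrreducible) (hp : p ≠ 0) (hidem : IsIdempotentElem (A ^ p)) (i j : ι)
    (hij : 0 < (A ^ p) i j) : 0 < (A ^ p) j i := by
  obtain ⟨b, hb, hji⟩ := (isIrreducible_iff_exists_pow_pos hA.nonneg).1 hA j i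
  exact pow_apply_pos_of_modEq hA.nonneg hidem hp hb.ne' (Nat.add_modEq_right)
    (pow_add_apply_pos hA.nonneg hji hij) hji

theorem rank_pow_le_of_isIrreducible [Field R] [IsStrictOrderedRing R] {A : Matrix ι ι R}
    (hA : A.IsIrreducible) (hp : p ≠ 0) (hidem : IsIdempotentElem (A ^ p)) :
    (A ^ p).rank ≤ p := by
  rcases isEmpty_or_nonempty ι with _ | ⟨⟨o⟩⟩
  · exact (rank_le_card_width _).trans (by simp)
  have hwalk := (isIrreducible_iff_exists_pow_pos hA.nonneg).1 hA
  choose len _ hlen using hwalk o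
  have : NeZero p := ⟨hp⟩
  refine (rank_le_card_of_forall_col_eq_smul (fun j => (len j : ZMod p))
    fun j k hjk => ?_).trans_eq (ZMod.card p)
  obtain ⟨b, hb, hjo⟩ := hwalk j o
  have hmod : b + len j ≡ b + len k [MOD p] :=
    ((ZMod.natCast_eq_natCast_iff _ _ _).1 hjk).add_left b
  have hEjk : 0 < (A ^ p) j k :=
    pow_apply_pos_of_modEq hA.nonneg hidem hp (by omega) hmod
      (pow_add_apply_pos hA.nonneg hjo (hlen j)) (pow_add_apply_pos hA.nonneg hjo (hlen k))
  exact col_eq_smul_col_of_isIdempotentElem (pow_apply_nonneg hA.nonneg p) hidem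
    (pow_apply_pos_symm_of_isIrreducible hA hp hidem) hEjk

theorem rank_le_of_isIrreducible_of_pow_succ_eq [Field R] [IsStrictOrderedRing R]
    {A : Matrix ι ι R} (hA : A.IsIrreducible) (hp : p ≠ 0) (hpot : A ^ (p + 1) = A) :
    A.rank ≤ p :=
  calc A.rank = (A ^ p * A).rank := by rw [← pow_succ, hpot]
    _ ≤ (A ^ p).rank := rank_mul_le_left _ _
    _ ≤ p := rank_pow_le_of_isIrreducible hA hp (isIdempotentElem_pow_of_pow_succ_eq hp hpot)

end Irreducible

end NonnegMatrix

open NonnegMatrix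

theorem mainTheorem1_general {ι R : Type*} [Fintype ι] [DecidableEq ι] [Field R] [LinearOrder R]
    [IsStrictOrderedRing R] {A : Matrix ι ι R} {r : ℕ} (hr : 2 ≤ r) (hA : ∀ i j, 0 ≤ A i j)
    (hpotent : A ^ r = A) :
    (r - 1 < A.rank → IsReducible A) ∧
    (Nontrivial ι → (∃ i, (A ^ (r - 1)) i i = 0) → IsReducible A) := by
  obtain ⟨p, rfl⟩ : ∃ p, r = p + 1 := ⟨r - 1, by omega⟩
  have hp : p ≠ 0 := by omega
  rw [Nat.add_sub_cancel]
  refine ⟨fun hrank => by_contra fun hred => ?_, fun _ ⟨i, hi⟩ => by_contra fun hred => ?_⟩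
  · have hcard : 1 < Fintype.card ι := by
      have := hrank.trans_le A.rank_le_card_width
      omega
    have := Fintype.one_lt_card_iff_nontrivial.1 hcard
    exact hrank.not_ge <|
      rank_le_of_isIrreducible_of_pow_succ_eq (isIrreducible_of_not_isReducible hA hred) hp hpotent
  · exact (pow_apply_self_pos_of_isIrreducible (isIrreducible_of_not_isReducible hA hred) hp
      (isIdempotentElem_pow_of_pow_succ_eq hp hpotent) i).ne' hi

theorem mainTheorem1 (n r : ℕ) (hr : 2 ≤ r) (A : Matrix (Fin n) (Fin n) ℝ)
    (hnonneg : ∀ i j, 0 ≤ A i j) (hpotent : A ^ r = A) :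
    (r - 1 < A.rank → A.IsDecomposable) ∧
    (2 ≤ n → 3 ≤ r → A.rank ≤ r - 1 → A.det = 0 →
      (∀ k : ℕ, 2 ≤ k → k ≤ r - 1 → ∃ i, (A ^ k) i i = 0) → A.IsDecomposable) := by
  have ⟨hrank, hdiag⟩ := mainTheorem1_general hr hnonneg hpotent
  exact ⟨fun h => (hrank h).isDecomposable, fun hn hr3 _ _ h =>
    (hdiag (Fin.nontrivial_iff_two_le.2 hn) (h (r - 1) (by omega) le_rfl)).isDecomposable⟩
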